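/- Let $L>1$ and $\Psi_i(x)=x/L+\nu_i$, $i=1,\dots,N$, be similitudes of $\mathbb R^2$, and let $\mathcal K^{\langle 0\rangle}$ be the unique nonempty compact set with $\mathcal K^{\langle 0\rangle}=\bigcup_i\Psi_i(\mathcal K^{\langle 0\rangle})$. Let $F$ be the set of fixed points of the $\Psi_i$ and let $V=V_0^{\langle 0\rangle}$ be the set of essential fixed points: those $x\in F$ for which there are $y\in F$, $y\ne x$, and $\Psi_i\neq\Psi_j$ with $\Psi_i(x)=\Psi_j(y)$. Put $k=\#V$. Assume that $\mathcal K^{\langle 0\rangle}$ is a simple nested fractal, i.e. (1) $k\ge 2$; (2) there is a nonempty open set $U\subset\mathbb R^2$ with $\Psi_i(U)\cap\Psi_j(U)=\emptyset$ for $i\ne j$ and $\bigcup_i\Psi_i(U)\subseteq U$; (3) $\Psi_i(\mathcal K^{\langle 0\rangle})\cap\Psi_j(\mathcal K^{\langle 0\rangle})=\Psi_i(V)\cap\Psi_j(V)$ for $i\neq j$; (4) for all distinct $x,y\in V$ and every $i$ there is $j$ with $S_{x,y}(\Psi_i(V))=\Psi_j(V)$, where $S_{x,y}$ is the reflection in the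 perpendicular bisector of $[x,y]$; (5) the graph on $\bigcup_i\Psi_i(V)$ in which two points are joined if both lie in one $\Psi_i(\mathcal K^{\langle 0\rangle})$ is connected. For $M\in\mathbb Z$ let $\mathcal K^{\langle M\rangle}=L^M\mathcal K^{\langle 0\rangle}$ and $\mathcal K^{\langle\infty\rangle}=\bigcup_{M\ge0}\mathcal K^{\langle M\rangle}$. An $M$-complex is a set $\Delta=\mathcal K^{\langle M\rangle}+\nu_\Delta\subset\mathcal K^{\langle\infty\rangle}$ with $\nu_\Delta=\sum_{j=M+1}^{J}L^j\nu_{i_j}$, $J\ge M+1$; its vertices are the points of $L^MV+\nu_\Delta$. The $0$-complexes in $\mathcal K^{\langle m\rangle}$, $m\ge1$, are those obtained with $J=m$. The fractal has the good labelling property (GLP) if for some $M\in\mathbb Z$ there is a map $\ell$ from the set of vertices of $M$-complexes (including $L^MV$) to a $k$-element set such that $\ell$ restricted to $L^MV$ is a bijection and for every $M$-complex $\mathcal K^{\langle M\rangle}+\nu_\Delta$ there is a rotation $R$ by a multiple of $2\pi/k$ around the barycenter of $\mathcal K^{\langle M\rangle}$ with $\ell(v)=\ell(R(v-\nu_\Delta))$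 for all vertices $v$ of the complex. Two complexes are adjacent if they are different and intersect; a cycle of length $j$ is a sequence $\Delta_1,\dots,\Delta_j$ of distinct complexes such that $\Delta_i$ is adjacent to $\Delta_{i+1}$ for $1\le i<j$ and $\Delta_j$ is adjacent to $\Delta_1$. Then, if $k$ is odd and the fractal has GLP, there is no cycle whose length is odd and less than $k$ consisting of $0$-complexes in $\mathcal K^{\langle 1\rangle}$, or, more generally, of $0$-complexes in $\mathcal K^{\langle m\rangle}$ for any $m\ge1$. If, moreover, $\nu_i=0$ for some $i$ (the usual normalization, which makes the sequence $\mathcal K^{\langle M\rangle}$ increasing), then there is no such cycle of $0$-complexes of $\mathcal K^{\langle\infty\rangle}$ at all. -/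

import Mathlib

open Set Topology Filter

/-- A system of similitudes `Ψ_i(x) = x / L + ν_i`, `i = 1, …, N`, of the Euclidean plane
(identified with `ℂ`), with a common scaling factor `L > 1`. -/
structure SimilitudeSystem where
  N : ℕ
  N_pos : 0 < N
  L : ℝ
  one_lt_L : 1 < L
  ν : Fin N → ℂ

namespace SimilitudeSystem

variable (S : SimilitudeSystem)

/-- The similitude `Ψ_i`. -/
noncomputable def Ψ (i : Fin S.N) (x : ℂ) : ℂ := x / (S.L : ℂ) + S.ν i

/-- The point `∑ L^{-n} ν_{ω(n)}` with the infinite address `ω`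
(auxiliary, used to prove that the fractal exists and is unique). -/
noncomputable def addr (ω : ℕ → Fin S.N) : ℂ := ∑' n, ((S.L : ℂ)⁻¹) ^ n * S.ν (ω n)

theorem norm_inv_lt : ‖(S.L : ℂ)⁻¹‖ < 1 := by
  have h := S.one_lt_L
  rw [norm_inv, Complex.norm_real, Real.norm_eq_abs, abs_of_pos (by linarith)]
  exact inv_lt_one_of_one_lt₀ h

theorem exists_norm_le : ∃ B : ℝ, ∀ i, ‖S.ν i‖ ≤ B := by
  obtain ⟨B, hB⟩ := (Set.finite_range fun i => ‖S.ν i‖).bddAbove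
  exact ⟨B, fun i => hB ⟨i, rfl⟩⟩

theorem term_le {B : ℝ} (hB : ∀ i, ‖S.ν i‖ ≤ B) (n : ℕ) (ω : ℕ → Fin S.N) :
    ‖((S.L : ℂ)⁻¹) ^ n * S.ν (ω n)‖ ≤ ‖(S.L : ℂ)⁻¹‖ ^ n * B := by
  rw [norm_mul, norm_pow]
  exact mul_le_mul_of_nonneg_left (hB _) (by positivity)

theorem summable_bound (B : ℝ) : Summable fun n : ℕ => ‖(S.L : ℂ)⁻¹‖ ^ n * B :=
  (summable_geometric_of_lt_one (norm_nonneg _) S.norm_inv_lt).mul_right B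

theorem summable_addr (ω : ℕ → Fin S.N) :
    Summable fun n => ((S.L : ℂ)⁻¹) ^ n * S.ν (ω n) := by
  obtain ⟨B, hB⟩ := S.exists_norm_le
  exact Summable.of_norm_bounded (S.summable_bound B) fun n => S.term_le hB n ω

theorem continuous_addr : Continuous S.addr := by
  obtain ⟨B, hB⟩ := S.exists_norm_le
  refine continuous_tsum (fun n => ?_) (S.summable_bound B) fun n ω => S.term_le hB n ω
  exact continuous_const.mul
    ((continuous_of_discreteTopology (f := S.ν)).comp (continuous_apply n))

theorem addr_eq (ω : ℕ → Fin S.N) : S.addr ω = S.Ψ (ω 0) (S.addr fun n => ω (n + 1)) := by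
  unfold addr Ψ
  rw [(S.summable_addr ω).tsum_eq_zero_add, add_comm, div_eq_inv_mul, ← tsum_mul_left]
  simp only [pow_zero, one_mul, pow_succ', mul_assoc]

theorem tendsto_partial (ω : ℕ → Fin S.N) {x : ℕ → ℂ} {C : ℝ} (hx : ∀ n, ‖x n‖ ≤ C) :
    Tendsto (fun m => (∑ n ∈ Finset.range m, ((S.L : ℂ)⁻¹) ^ n * S.ν (ω n))
      + ((S.L : ℂ)⁻¹) ^ m * x m) atTop (𝓝 (S.addr ω)) := by
  have h1 := (S.summable_addr ω).hasSum.tendsto_sum_nat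
  have h2 : Tendsto (fun m => ((S.L : ℂ)⁻¹) ^ m * x m) atTop (𝓝 0) := by
    have h3 := (S.summable_bound C).tendsto_atTop_zero
    refine squeeze_zero_norm (fun m => ?_) h3
    rw [norm_mul, norm_pow]
    exact mul_le_mul_of_nonneg_left (hx m) (by positivity)
  have h4 := h1.add h2
  rw [add_zero] at h4
  exact h4

theorem existsUnique_fractal :
    ∃! K : Set ℂ, K.Nonempty ∧ IsCompact K ∧ K = ⋃ i, S.Ψ i '' K := by
  have hN : Nonempty (Fin S.N) := ⟨⟨0, S.N_pos⟩⟩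
  refine ⟨range S.addr, ⟨range_nonempty _, isCompact_range S.continuous_addr, ?_⟩, ?_⟩
  · ext z
    simp only [mem_range, mem_iUnion, mem_image]
    constructor
    · rintro ⟨ω, rfl⟩
      exact ⟨ω 0, _, ⟨_, rfl⟩, (S.addr_eq ω).symm⟩
    · rintro ⟨i, _, ⟨ω, rfl⟩, rfl⟩
      exact ⟨fun n => Nat.casesOn n i ω, S.addr_eq _⟩
  · rintro K ⟨⟨y, hy⟩, hc, hK⟩
    obtain ⟨C, hC⟩ := hc.isBounded.exists_norm_le
    have hstep : ∀ x : K, ∃ (i : Fin S.N) (x' : K), (x : ℂ) = S.Ψ i x' := by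
      rintro ⟨x, hx⟩
      have hx2 := hx
      rw [hK] at hx2
      simp only [mem_iUnion, mem_image] at hx2
      obtain ⟨i, x', h1, h2⟩ := hx2
      exact ⟨i, ⟨x', h1⟩, h2.symm⟩
    have hmem : ∀ i x, x ∈ K → S.Ψ i x ∈ K := by
      intro i x hx
      rw [hK]
      exact mem_iUnion.2 ⟨i, x, hx, rfl⟩
    apply Subset.antisymm
    · intro x hx
      choose f g hfg using hstep
      let u : ℕ → K := fun n => g^[n] ⟨x, hx⟩
      let ω : ℕ → Fin S.N := fun n => f (u n)
      have key : ∀ m, (∑ n ∈ Finset.range m, ((S.L : ℂ)⁻¹) ^ n * S.ν (ω n))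
          + ((S.L : ℂ)⁻¹) ^ m * (u m : ℂ) = x := by
        intro m
        induction m with
        | zero => simp [u]
        | succ m ih =>
          have h : (u m : ℂ) = S.Ψ (ω m) (u (m + 1)) := by
            have h2 : u (m + 1) = g (u m) := Function.iterate_succ_apply' g m _
            rw [h2]
            exact hfg (u m)
          rw [h] at ih
          rw [← ih, Finset.sum_range_succ]
          unfold Ψ
          rw [div_eq_inv_mul]
          ring
      have ht := S.tendsto_partial ω (x := fun n => (u n : ℂ)) fun n => hC _ (u n).2
      simp only [key] at ht
      exact ⟨ω, tendsto_nhds_unique ht tendsto_const_nhds⟩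
    · rintro _ ⟨ω, rfl⟩
      have key : ∀ (m : ℕ) (ω : ℕ → Fin S.N),
          (∑ n ∈ Finset.range m, ((S.L : ℂ)⁻¹) ^ n * S.ν (ω n))
            + ((S.L : ℂ)⁻¹) ^ m * y ∈ K := by
        intro m
        induction m with
        | zero => intro ω; simpa using hy
        | succ m ih =>
          intro ω
          have h := hmem (ω 0) _ (ih fun n => ω (n + 1))
          convert h using 1
          unfold Ψ
          rw [Finset.sum_range_succ', div_eq_inv_mul, mul_add, Finset.mul_sum]
          simp only [pow_succ', mul_assoc]
          simp only [pow_zero, one_mul]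
          ring
      exact hc.isClosed.mem_of_tendsto
        (S.tendsto_partial ω (x := fun _ => y) (C := ‖y‖) fun _ => le_rfl)
        (Eventually.of_forall fun m => key m ω)

/-- The fractal `K^⟨0⟩` generated by the system: the unique nonempty compact set with
`K = ⋃ i, Ψ_i(K)`. -/
noncomputable def fractal : Set ℂ := S.existsUnique_fractal.choose

theorem fractal_spec :
    S.fractal.Nonempty ∧ IsCompact S.fractal ∧ S.fractal = ⋃ i, S.Ψ i '' S.fractal :=
  S.existsUnique_fractal.choose_spec.1

/-- The set `F` of fixed points of `Ψ_1, …, Ψ_N`. -/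
def fixedPts : Set ℂ := {x | ∃ i, S.Ψ i x = x}

/-- The set `V_0^⟨0⟩` of essential fixed points. -/
def essFixedPts : Set ℂ :=
  {x | x ∈ S.fixedPts ∧
    ∃ y ∈ S.fixedPts, y ≠ x ∧ ∃ i j, S.Ψ i ≠ S.Ψ j ∧ S.Ψ i x = S.Ψ j y}

/-- The number `k` of essential fixed points. -/
noncomputable def k : ℕ := S.essFixedPts.ncard

/-- The symmetry `S_{x,y}` with respect to the line bisecting the segment `[x, y]`
(the perpendicular bisector). -/
noncomputable def bisectorReflection (x y : ℂ) : ℂ → ℂ :=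
  haveI : Nonempty (AffineSubspace.perpBisector x y) :=
    AffineSubspace.perpBisector_nonempty.to_subtype
  EuclideanGeometry.reflection (AffineSubspace.perpBisector x y)

/-- The graph `E_{-1}` on `V_{-1}^⟨0⟩ = ⋃ i, Ψ_i(V_0^⟨0⟩)`: two points are joined
if they lie in a common `Ψ_i(K^⟨0⟩)`. -/
def cellGraph : SimpleGraph (⋃ i, S.Ψ i '' S.essFixedPts : Set ℂ) where
  Adj x y := x ≠ y ∧ ∃ i, (x : ℂ) ∈ S.Ψ i '' S.fractal ∧ (y : ℂ) ∈ S.Ψ i '' S.fractal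
  symm := ⟨fun _ _ h => ⟨h.1.symm, h.2.imp fun _ hi => ⟨hi.2, hi.1⟩⟩⟩
  loopless := ⟨fun _ h => h.1 rfl⟩

/-- The fractal generated by the system is a simple nested fractal. -/
structure IsSimpleNestedFractal : Prop where
  two_le : 2 ≤ S.k
  openSet : ∃ U : Set ℂ, IsOpen U ∧ U.Nonempty ∧
    (∀ i j, i ≠ j → Disjoint (S.Ψ i '' U) (S.Ψ j '' U)) ∧ (⋃ i, S.Ψ i '' U) ⊆ U
  nesting : ∀ i j, i ≠ j →
    S.Ψ i '' S.fractal ∩ S.Ψ j '' S.fractal =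
      S.Ψ i '' S.essFixedPts ∩ S.Ψ j '' S.essFixedPts
  symmetry : ∀ i, ∀ x ∈ S.essFixedPts, ∀ y ∈ S.essFixedPts, x ≠ y →
    ∃ j, bisectorReflection x y '' (S.Ψ i '' S.essFixedPts) = S.Ψ j '' S.essFixedPts
  connectivity : S.cellGraph.Connected

/-- `K^⟨M⟩ = L^M K^⟨0⟩`. -/
noncomputable def scaledFractal (M : ℤ) : Set ℂ := (fun x => (S.L : ℂ) ^ M * x) '' S.fractal

/-- The unbounded fractal `K^⟨∞⟩ = ⋃_{M ≥ 0} K^⟨M⟩`. -/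
noncomputable def unboundedFractal : Set ℂ := ⋃ M : ℕ, S.scaledFractal (M : ℤ)

/-- `V_M^⟨M⟩ = L^M V_0^⟨0⟩`, the vertices of `K^⟨M⟩`. -/
noncomputable def vertices (M : ℤ) : Set ℂ := (fun x => (S.L : ℂ) ^ M * x) '' S.essFixedPts

/-- The translation vector `∑_{j=M+1}^{M+m} L^j ν_{i_j}` coded by the word
`w = (i_{M+1}, …, i_{M+m})`. -/
noncomputable def shift (M : ℤ) {m : ℕ} (w : Fin m → Fin S.N) : ℂ :=
  ∑ j : Fin m, (S.L : ℂ) ^ (M + 1 + (j : ℕ) : ℤ) * S.ν (w j)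

/-- The set `K^⟨M⟩ + ∑_{j=M+1}^{M+m} L^j ν_{i_j}`. -/
noncomputable def complexOf (M : ℤ) {m : ℕ} (w : Fin m → Fin S.N) : Set ℂ :=
  (fun x => x + S.shift M w) '' S.scaledFractal M

/-- The vertices of `complexOf M w`. -/
noncomputable def complexVertices (M : ℤ) {m : ℕ} (w : Fin m → Fin S.N) : Set ℂ :=
  (fun x => x + S.shift M w) '' S.vertices M

/-- `Δ` is one of the `M`-complexes that make up `K^⟨M+m⟩`. -/
def IsComplexIn (M : ℤ) (m : ℕ) (Δ : Set ℂ) : Prop :=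
  ∃ w : Fin m → Fin S.N, Δ = S.complexOf M w

/-- `Δ` is an `M`-complex of the unbounded fractal. -/
def IsComplex (M : ℤ) (Δ : Set ℂ) : Prop :=
  Δ ⊆ S.unboundedFractal ∧ ∃ m : ℕ, 1 ≤ m ∧ S.IsComplexIn M m Δ

/-- The barycenter of `K^⟨M⟩`, i.e. of the regular polygon spanned by its vertices. -/
noncomputable def barycenter (M : ℤ) : ℂ := (∑ᶠ v ∈ S.vertices M, v) / (S.k : ℂ)

/-- The rotation `R_r` by the angle `2πr/k` around the barycenter of `K^⟨M⟩`. -/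
noncomputable def rotation (M : ℤ) (r : ℕ) (x : ℂ) : ℂ :=
  S.barycenter M +
    Complex.exp (2 * Real.pi * Complex.I * r / S.k) * (x - S.barycenter M)

/-- `ℓ` is a good labelling function of order `M`, with the alphabet `Fin k`. A labelling is
given here by a function on the whole plane; only its values at the vertices of `M`-complexes
matter. -/
structure IsGoodLabelling (M : ℤ) (ℓ : ℂ → Fin S.k) : Prop where
  bijOn : Set.BijOn ℓ (S.vertices M) Set.univ
  rotate : ∀ (m : ℕ) (w : Fin m → Fin S.N), 1 ≤ m → S.complexOf M w ⊆ S.unboundedFractal →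
    ∃ r ∈ Finset.Icc 1 S.k, ∀ v ∈ S.complexVertices M w,
      ℓ v = ℓ (S.rotation M r (v - S.shift M w))

/-- The good labelling property (of some order `M`). -/
def HasGLP : Prop := ∃ (M : ℤ) (ℓ : ℂ → Fin S.k), S.IsGoodLabelling M ℓ

end SimilitudeSystem

/-- Two complexes are adjacent: they are different and intersect. -/
def AdjacentComplexes (Δ Δ' : Set ℂ) : Prop := Δ ≠ Δ' ∧ (Δ ∩ Δ').Nonempty

/-- A cycle of length `j`: distinct sets, each adjacent to the next one and
the last one adjacent to the first one. -/
def IsComplexCycle {j : ℕ} (c : Fin j → Set ℂ) : Prop :=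
  Function.Injective c ∧ ∀ i, AdjacentComplexes (c i) (c (finRotate j i))

/-! ### Words, translation vectors and intersections of complexes -/

namespace SimilitudeSystem

variable (S : SimilitudeSystem)

/-! The vertices of the fractal form a regular `k`-gon (`exists_regular_polygon`), so the positions
of vertices in a complex are `k`-th roots of unity. GLP attaches to each complex a root of unity
`η`: the vertex at position `p` has the label `ℓ₀ (η * p)`, with `ℓ₀` injective
(`HasGLP.exists_labelling`). If adjacent complexes share a vertex, at position `p` in one and `q` in
the other, equality of labels gives `η' = η * (p / q)`.

The crux is `sq_div_eq`: for odd `k`, `p` and `q` are nearly opposite, i.e. `(p / q) ^ 2 = ζ ^ (±1)`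
with `ζ = exp (2πi/k)`. The two complexes are mirror images in a line through the shared vertex. A
point of the first one on this line lies in both, hence is a vertex, and parity of `k` leaves only
the shared one. So the line cuts the connected fractal at a single vertex; since reflections
exchange this vertex with any other, all vertices lie on one side of the line
(`forall_le_of_isPreconnected`). Testing the two neighbours of `p` leaves two directions for the
line (`sq_eq_of_forall_re_nonpos`).

Around a cycle the ratios multiply to `1`. Squaring, `k` divides a sum of `j` signs; as `j < k` the
sum is zero, which is impossible for odd `j` (`no_short_odd_product`). -/

theorem L_ne_zero : (S.L : ℂ) ≠ 0 := by
  have h := S.one_lt_L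
  exact_mod_cast (by linarith : S.L ≠ 0)

theorem Ψ_injective (i : Fin S.N) : Function.Injective (S.Ψ i) := by
  intro x y h
  have := S.L_ne_zero
  unfold Ψ at h
  field_simp at h
  simpa using h

theorem Ψ_mem_fractal (i : Fin S.N) {x : ℂ} (hx : x ∈ S.fractal) : S.Ψ i x ∈ S.fractal := by
  rw [S.fractal_spec.2.2]
  exact mem_iUnion.2 ⟨i, x, hx, rfl⟩

theorem fixedPts_subset_fractal : S.fixedPts ⊆ S.fractal := by
  rintro x ⟨i, hx⟩
  obtain ⟨y, hy⟩ := S.fractal_spec.1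
  have hmem : ∀ n : ℕ, x + ((S.L : ℂ)⁻¹) ^ n * (y - x) ∈ S.fractal := by
    intro n
    induction n with
    | zero => simpa using hy
    | succ n ih =>
      have h := S.Ψ_mem_fractal i ih
      convert h using 1
      conv_lhs => rw [← hx]
      unfold Ψ
      rw [div_eq_inv_mul, div_eq_inv_mul]
      have h2 : S.ν i = x - (S.L : ℂ)⁻¹ * x := by
        conv_rhs => enter [1]; rw [← hx]
        unfold Ψ
        rw [div_eq_inv_mul]
        ring
      rw [h2]
      ring
  have ht : Tendsto (fun n : ℕ => x + ((S.L : ℂ)⁻¹) ^ n * (y - x)) atTop (𝓝 x) := by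
    have h := (tendsto_pow_atTop_nhds_zero_of_norm_lt_one S.norm_inv_lt).mul_const (y - x)
    simpa using h.const_add x
  exact S.fractal_spec.2.1.isClosed.mem_of_tendsto ht (Eventually.of_forall hmem)

theorem essFixedPts_subset_fractal : S.essFixedPts ⊆ S.fractal :=
  fun _ hx => S.fixedPts_subset_fractal hx.1

theorem shift_eq_mul (M : ℤ) {m : ℕ} (w : Fin m → Fin S.N) :
    S.shift M w = (S.L : ℂ) ^ M * S.shift 0 w := by
  unfold shift
  rw [Finset.mul_sum]
  refine Finset.sum_congr rfl fun j _ => ?_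
  rw [← mul_assoc, ← zpow_add₀ S.L_ne_zero]
  congr 2
  ring

theorem shift_succ {m : ℕ} (w : Fin (m + 1) → Fin S.N) :
    S.shift 0 w = S.shift 0 (Fin.init w : Fin m → Fin S.N)
      + (S.L : ℂ) ^ (m + 1) * S.ν (w (Fin.last m)) := by
  unfold shift
  rw [Fin.sum_univ_castSucc]
  congr 2
  rw [← zpow_natCast]
  congr 1
  simp only [Fin.val_last]
  push_cast
  ring

theorem exists_add_shift_eq {A : Set ℂ} (hA : ∀ i, ∀ x ∈ A, S.Ψ i x ∈ A) {m : ℕ}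
    (w : Fin m → Fin S.N) {x : ℂ} (hx : x ∈ A) :
    ∃ q ∈ A, x + S.shift 0 w = (S.L : ℂ) ^ m * q := by
  induction m with
  | zero => exact ⟨x, hx, by simp [shift]⟩
  | succ m ih =>
    obtain ⟨q, hq, h⟩ := ih (Fin.init w)
    refine ⟨_, hA (w (Fin.last m)) q hq, ?_⟩
    rw [shift_succ, ← add_assoc, h]
    have := S.L_ne_zero
    unfold Ψ
    field_simp
    ring

/-- The last letter has the largest scale: it names the first-level cell, enlarged by `L ^ (m + 1)`,
that contains `z`, and the remaining letters locate the point inside this cell. Inductions on words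
peel off this letter. -/
theorem exists_eq_of_sub_shift_mem {A : Set ℂ} (hA : ∀ i, ∀ x ∈ A, S.Ψ i x ∈ A) {m : ℕ}
    (w : Fin (m + 1) → Fin S.N) {z : ℂ} (hz : z - S.shift 0 w ∈ A) :
    ∃ q ∈ A, z = (S.L : ℂ) ^ (m + 1) * S.Ψ (w (Fin.last m)) q ∧
      z - S.shift 0 w = (S.L : ℂ) ^ m * q - S.shift 0 (Fin.init w : Fin m → Fin S.N) := by
  obtain ⟨q, hq, h⟩ := S.exists_add_shift_eq hA (Fin.init w : Fin m → Fin S.N) hz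
  refine ⟨q, hq, ?_, by rw [← h]; ring⟩
  have h0 := S.L_ne_zero
  have : z = (S.L : ℂ) ^ m * q + (S.L : ℂ) ^ (m + 1) * S.ν (w (Fin.last m)) := by
    rw [← h, shift_succ]; ring
  rw [this]
  unfold Ψ
  field_simp
  ring

theorem complexOf_subset_unboundedFractal {M : ℤ} {m : ℕ} (h : 0 ≤ M + m)
    (w : Fin m → Fin S.N) : S.complexOf M w ⊆ S.unboundedFractal := by
  rintro _ ⟨_, ⟨x, hx, rfl⟩, rfl⟩
  obtain ⟨q, hq, hxq⟩ := S.exists_add_shift_eq (fun i x => S.Ψ_mem_fractal i) w hx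
  refine mem_iUnion.2 ⟨(M + m).toNat, q, hq, ?_⟩
  rw [Int.toNat_of_nonneg h]
  simp only
  rw [shift_eq_mul, ← mul_add, hxq, ← mul_assoc, zpow_add₀ S.L_ne_zero, zpow_natCast]

theorem mem_complexOf_zero {m : ℕ} {w : Fin m → Fin S.N} {z : ℂ} :
    z ∈ S.complexOf 0 w ↔ z - S.shift 0 w ∈ S.fractal := by
  constructor
  · rintro ⟨_, ⟨x, hx, rfl⟩, rfl⟩
    simpa using hx
  · intro h
    exact ⟨_, ⟨_, h, rfl⟩, by simp⟩

variable {S}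

namespace IsSimpleNestedFractal

/-- The open sets `Ψ_i(U)` are disjoint, so a point of the translate of `U` determines the letters
of the word, from the last one down. -/
theorem shift_injective (hS : S.IsSimpleNestedFractal) (m : ℕ) :
    Function.Injective fun w : Fin m → Fin S.N => S.shift 0 w := by
  obtain ⟨U, -, ⟨u, hu⟩, hd, hU⟩ := hS.openSet
  have hA : ∀ i, ∀ x ∈ U, S.Ψ i x ∈ U := fun i x hx => hU (mem_iUnion.2 ⟨i, x, hx, rfl⟩)
  have key : ∀ (m : ℕ) (w w' : Fin m → Fin S.N) (z : ℂ), z - S.shift 0 w ∈ U →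
      z - S.shift 0 w' ∈ U → w = w' := by
    intro m
    induction m with
    | zero => intro w w' z _ _; exact Subsingleton.elim _ _
    | succ m ih =>
      intro w w' z h h'
      obtain ⟨q, hq, hz, hs⟩ := S.exists_eq_of_sub_shift_mem hA w h
      obtain ⟨q', hq', hz', hs'⟩ := S.exists_eq_of_sub_shift_mem hA w' h'
      have hΨ : S.Ψ (w (Fin.last m)) q = S.Ψ (w' (Fin.last m)) q' :=
        mul_left_cancel₀ (pow_ne_zero _ S.L_ne_zero) (hz.symm.trans hz')
      have hl : w (Fin.last m) = w' (Fin.last m) := by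
        by_contra hne
        exact (disjoint_left.1 (hd _ _ hne)) ⟨q, hq, rfl⟩ ⟨q', hq', hΨ.symm⟩
      rw [hl] at hΨ
      obtain rfl := S.Ψ_injective _ hΨ
      rw [hs] at h
      rw [hs'] at h'
      rw [← Fin.snoc_init_self w, ← Fin.snoc_init_self w', ih _ _ _ h h', hl]
  intro w w' h
  refine key m w w' (u + S.shift 0 w) (by simpa using hu) ?_
  simp only at h
  rw [← h]
  simpa using hu

theorem ν_injective (hS : S.IsSimpleNestedFractal) : Function.Injective S.ν := by
  intro i j h
  have := hS.shift_injective 1 (a₁ := fun _ => i) (a₂ := fun _ => j) (by simp [shift, h])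
  exact congrFun this 0

theorem essFixedPts_finite (hS : S.IsSimpleNestedFractal) : S.essFixedPts.Finite :=
  Set.finite_of_ncard_pos (lt_of_lt_of_le two_pos hS.two_le)

/-- The point also lies in the cell of the map that fixes it, so nesting applies to any other cell.
-/
theorem mem_image_of_mem (hS : S.IsSimpleNestedFractal) {i : Fin S.N} {x : ℂ}
    (hx : x ∈ S.essFixedPts)
    (hi : x ∈ S.Ψ i '' S.fractal) : x ∈ S.Ψ i '' S.essFixedPts := by
  obtain ⟨i₀, h₀⟩ := hx.1
  by_cases h : i = i₀
  · subst h; exact ⟨x, hx, h₀⟩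
  · have : x ∈ S.Ψ i '' S.fractal ∩ S.Ψ i₀ '' S.fractal :=
      ⟨hi, x, S.essFixedPts_subset_fractal hx, h₀⟩
    rw [hS.nesting _ _ h] at this
    exact this.1

theorem mem_essFixedPts_of_sub_shift_mem (hS : S.IsSimpleNestedFractal) {m : ℕ}
    (w : Fin m → Fin S.N) {q : ℂ}
    (hq : q ∈ S.essFixedPts) (h : (S.L : ℂ) ^ m * q - S.shift 0 w ∈ S.fractal) :
    (S.L : ℂ) ^ m * q - S.shift 0 w ∈ S.essFixedPts := by
  induction m generalizing q with
  | zero => simpa [shift] using hq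
  | succ m ih =>
    obtain ⟨q', hq', hz, hs⟩ :=
      S.exists_eq_of_sub_shift_mem (fun i x => S.Ψ_mem_fractal i) w h
    have hΨ := mul_left_cancel₀ (pow_ne_zero _ S.L_ne_zero) hz
    obtain ⟨v, hv, hvq⟩ := hS.mem_image_of_mem hq ⟨q', hq', hΨ.symm⟩
    obtain rfl := S.Ψ_injective _ (hvq.trans hΨ)
    rw [hs] at h ⊢
    exact ih _ hv h

/-- Equal last letters are peeled off. At the first difference nesting makes the common point a
vertex of both cells, and `mem_essFixedPts_of_sub_shift_mem` carries this down to the small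
complexes. -/
theorem mem_essFixedPts_of_mem_inter (hS : S.IsSimpleNestedFractal) {m : ℕ} (w w' : Fin m → Fin S.N)
    (hne : w ≠ w') {z : ℂ} (h : z - S.shift 0 w ∈ S.fractal)
    (h' : z - S.shift 0 w' ∈ S.fractal) :
    z - S.shift 0 w ∈ S.essFixedPts ∧ z - S.shift 0 w' ∈ S.essFixedPts := by
  induction m generalizing z with
  | zero => exact absurd (Subsingleton.elim _ _) hne
  | succ m ih =>
    obtain ⟨q, hq, hz, hs⟩ :=
      S.exists_eq_of_sub_shift_mem (fun i x => S.Ψ_mem_fractal i) w h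
    obtain ⟨q', hq', hz', hs'⟩ :=
      S.exists_eq_of_sub_shift_mem (fun i x => S.Ψ_mem_fractal i) w' h'
    have hΨ : S.Ψ (w (Fin.last m)) q = S.Ψ (w' (Fin.last m)) q' :=
      mul_left_cancel₀ (pow_ne_zero _ S.L_ne_zero) (hz.symm.trans hz')
    rw [hs] at h
    rw [hs'] at h'
    rw [hs, hs']
    by_cases hl : w (Fin.last m) = w' (Fin.last m)
    · rw [hl] at hΨ
      obtain rfl := S.Ψ_injective _ hΨ
      refine ih _ _ (fun hi => hne ?_) h h'
      rw [← Fin.snoc_init_self w, ← Fin.snoc_init_self w', hi, hl]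
    · have hin : S.Ψ (w (Fin.last m)) q ∈
          S.Ψ (w (Fin.last m)) '' S.fractal ∩ S.Ψ (w' (Fin.last m)) '' S.fractal :=
        ⟨⟨q, hq, rfl⟩, ⟨q', hq', hΨ.symm⟩⟩
      rw [hS.nesting _ _ hl] at hin
      obtain ⟨⟨v, hv, hv1⟩, v', hv', hv2⟩ := hin
      obtain rfl := S.Ψ_injective _ hv1
      obtain rfl := S.Ψ_injective _ (hv2.trans hΨ)
      exact ⟨hS.mem_essFixedPts_of_sub_shift_mem _ hv h,
        hS.mem_essFixedPts_of_sub_shift_mem _ hv' h'⟩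

/-- If every vertex lay in two cells, the number of cells at level `m` through a vertex would be
unbounded, although these cells have distinct translation vectors. -/
theorem not_forall_mem_two_cells (hS : S.IsSimpleNestedFractal) :
    ¬ ∀ x ∈ S.essFixedPts, ∃ i j, i ≠ j ∧ x ∈ S.Ψ i '' S.essFixedPts ∧
      x ∈ S.Ψ j '' S.essFixedPts := by
  classical
  intro H
  have ext : ∀ (m : ℕ) (i : Fin S.N) (u : Fin m → Fin S.N) (v : ℂ),
      (S.L : ℂ) ^ (m + 1) * S.Ψ i v - S.shift 0 (Fin.snoc u i : Fin (m + 1) → Fin S.N) =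
        (S.L : ℂ) ^ m * v - S.shift 0 u := by
    intro m i u v
    rw [shift_succ, Fin.init_snoc, Fin.snoc_last]
    have := S.L_ne_zero
    unfold Ψ
    field_simp
    ring
  -- The `m + 1` words obtained through cell `i`, together with a single word through cell `j`, give
  -- `m + 2` words at the next level.
  have grow : ∀ m : ℕ, ∀ x ∈ S.essFixedPts, ∃ T : Finset (Fin m → Fin S.N),
      m + 1 ≤ T.card ∧ ∀ w ∈ T, (S.L : ℂ) ^ m * x - S.shift 0 w ∈ S.essFixedPts := by
    intro m
    induction m with
    | zero => intro x hx; exact ⟨Finset.univ, by simp, by simpa [shift] using hx⟩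
    | succ m ih =>
      intro x hx
      obtain ⟨i, j, hij, ⟨v, hv, hiv⟩, v', hv', hjv⟩ := H x hx
      obtain ⟨T, hT, hTm⟩ := ih v hv
      obtain ⟨T', hT', hTm'⟩ := ih v' hv'
      obtain ⟨w', hw'⟩ := Finset.card_pos.1 (by omega : 0 < T'.card)
      have hinj : Function.Injective
          fun u : Fin m → Fin S.N => (Fin.snoc u i : Fin (m + 1) → Fin S.N) := by
        intro a b hab
        have := congrArg (Fin.init (α := fun _ => Fin S.N)) hab
        simpa using this
      refine ⟨insert (Fin.snoc w' j : Fin (m + 1) → Fin S.N)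
        (T.image fun u => (Fin.snoc u i : Fin (m + 1) → Fin S.N)), ?_, ?_⟩
      · rw [Finset.card_insert_of_notMem, Finset.card_image_of_injective _ hinj]
        · omega
        · intro hmem
          obtain ⟨u, -, hu⟩ := Finset.mem_image.1 hmem
          have := congrFun hu (Fin.last m)
          simp only [Fin.snoc_last] at this
          exact hij this
      · intro w hw
        rcases Finset.mem_insert.1 hw with rfl | hw
        · rw [← hjv, ext]; exact hTm' _ hw'
        · obtain ⟨u, hu, rfl⟩ := Finset.mem_image.1 hw
          rw [← hiv, ext]; exact hTm _ hu
  obtain ⟨x, hx⟩ : S.essFixedPts.Nonempty :=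
    (Set.ncard_pos hS.essFixedPts_finite).1 (lt_of_lt_of_le two_pos hS.two_le)
  -- At level `k` there are `k + 1` words, but distinct words put the point at distinct positions in
  -- `V`, which has only `k` elements.
  obtain ⟨T, hT, hTm⟩ := grow S.k x hx
  have hle : T.card ≤ hS.essFixedPts_finite.toFinset.card := by
    refine Finset.card_le_card_of_injOn
      (fun w => (S.L : ℂ) ^ S.k * x - S.shift 0 w) (fun w hw => by simpa using hTm w hw) ?_
    intro w _ w' _ h
    exact hS.shift_injective _ (sub_right_injective h)
  rw [← Set.ncard_eq_toFinset_card _ hS.essFixedPts_finite] at hle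
  exact absurd (hT.trans hle) (by unfold k; omega)

end IsSimpleNestedFractal
end SimilitudeSystem

/-! ### Reflections preserve the vertex set and the fractal; connectedness -/

namespace SimilitudeSystem
open scoped ComplexConjugate

theorem bisectorReflection_apply {x y : ℂ} (hxy : x ≠ y) (z : ℂ) :
    bisectorReflection x y z = -((y - x) / conj (y - x)) * conj z
      + (x + (y - x) / conj (y - x) * conj y) := by
  have hne : y - x ≠ 0 := sub_ne_zero.2 hxy.symm
  have hne' : conj (y - x) ≠ 0 := (map_ne_zero _).2 hne
  set u : ℂ := (z - x) / (y - x) with hu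
  have hz : z = x + (y - x) * u := by rw [hu]; field_simp; ring
  have : Nonempty (AffineSubspace.perpBisector x y) :=
    AffineSubspace.perpBisector_nonempty.to_subtype
  -- In the coordinate `u` the bisector is `Re u = 1/2`; this point is the foot of the perpendicular
  -- from `z`, and the reflection is `u ↦ 1 - conj u`.
  have hp : x + (y - x) * (1 / 2 + u.im * Complex.I) ∈ AffineSubspace.perpBisector x y := by
    rw [AffineSubspace.mem_perpBisector_iff_dist_eq, dist_eq_norm, dist_eq_norm]
    have h1 : x + (y - x) * (1 / 2 + u.im * Complex.I) - x
        = (y - x) * (1 / 2 + u.im * Complex.I) := by ring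
    have h2 : x + (y - x) * (1 / 2 + u.im * Complex.I) - y
        = -((y - x) * conj (1 / 2 + u.im * Complex.I)) := by
      simp only [map_add, map_mul, map_div₀, map_one, map_ofNat, Complex.conj_I,
        Complex.conj_ofReal]
      ring
    rw [h1, h2, norm_neg, norm_mul, norm_mul, Complex.norm_conj]
  have hv : ((u.re - 1 / 2 : ℝ) : ℂ) * (y - x)
      ∈ (AffineSubspace.perpBisector x y).directionᗮ := by
    rw [AffineSubspace.direction_perpBisector]
    apply Submodule.le_orthogonal_orthogonal
    exact Submodule.mem_span_singleton.2 ⟨u.re - 1 / 2, by simp⟩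
  have h := EuclideanGeometry.reflection_orthogonal_vadd hp hv
  have hzz : z = ((u.re - 1 / 2 : ℝ) : ℂ) * (y - x) +ᵥ
      (x + (y - x) * (1 / 2 + u.im * Complex.I)) := by
    conv_lhs => rw [hz, ← Complex.re_add_im u]
    simp only [vadd_eq_add]
    push_cast
    ring
  have hcz : conj z = conj x + conj (y - x) * conj u := by rw [hz]; simp
  have hcu : conj u = u.re - u.im * Complex.I := by
    apply Complex.ext <;> simp
  calc bisectorReflection x y z
      = -(((u.re - 1 / 2 : ℝ) : ℂ) * (y - x)) +ᵥ
        (x + (y - x) * (1 / 2 + u.im * Complex.I)) := by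
        rw [← h]
        conv_lhs => rw [hzz]
        rfl
    _ = x + (y - x) * (1 - conj u) := by
        rw [hcu, vadd_eq_add]; push_cast; ring
    _ = _ := by
        rw [hcz]
        field_simp
        simp only [map_sub]
        ring

theorem bisectorReflection_left {x y : ℂ} (hxy : x ≠ y) : bisectorReflection x y x = y := by
  have hne' : conj (y - x) ≠ 0 := (map_ne_zero _).2 (sub_ne_zero.2 hxy.symm)
  rw [bisectorReflection_apply hxy]
  field_simp
  simp only [map_sub]
  ring

theorem bisectorReflection_involutive (x y : ℂ) :
    Function.Involutive (bisectorReflection x y) := by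
  have : Nonempty (AffineSubspace.perpBisector x y) :=
    AffineSubspace.perpBisector_nonempty.to_subtype
  exact EuclideanGeometry.reflection_reflection _

theorem continuous_bisectorReflection (x y : ℂ) : Continuous (bisectorReflection x y) := by
  have : Nonempty (AffineSubspace.perpBisector x y) :=
    AffineSubspace.perpBisector_nonempty.to_subtype
  exact (EuclideanGeometry.reflection (AffineSubspace.perpBisector x y)).continuous

theorem dist_bisectorReflection (x y p q : ℂ) :
    dist (bisectorReflection x y p) (bisectorReflection x y q) = dist p q := by
  have : Nonempty (AffineSubspace.perpBisector x y) :=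
    AffineSubspace.perpBisector_nonempty.to_subtype
  exact (EuclideanGeometry.reflection (AffineSubspace.perpBisector x y)).dist_map p q

theorem bisectorReflection_Ψ (S : SimilitudeSystem) {x y : ℂ} (hxy : x ≠ y) (i : Fin S.N) :
    ∃ μ : ℂ, ∀ z, bisectorReflection x y (S.Ψ i z) = bisectorReflection x y z / S.L + μ := by
  refine ⟨-((y - x) / conj (y - x)) * conj (S.ν i) + (x + (y - x) / conj (y - x) * conj y)
    - (x + (y - x) / conj (y - x) * conj y) / S.L, fun z => ?_⟩
  rw [bisectorReflection_apply hxy, bisectorReflection_apply hxy]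
  unfold Ψ
  rw [map_add, map_div₀, Complex.conj_ofReal]
  ring

theorem eq_zero_of_image_add_subset {A : Set ℂ} (hA : A.Finite) (hne : A.Nonempty) {u : ℂ}
    (h : ∀ x ∈ A, x + u ∈ A) : u = 0 := by
  obtain ⟨x, hx⟩ := hne
  by_contra hu
  have hmem : ∀ n : ℕ, x + n * u ∈ A := by
    intro n
    induction n with
    | zero => simpa using hx
    | succ n ih => convert h _ ih using 1; push_cast; ring
  refine Set.infinite_of_injective_forall_mem (f := fun n : ℕ => x + n * u) ?_ hmem hA
  intro a b hab
  simpa [hu] using hab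

variable {S : SimilitudeSystem}

namespace IsSimpleNestedFractal

theorem essFixedPts_nonempty (hS : S.IsSimpleNestedFractal) : S.essFixedPts.Nonempty :=
  (Set.ncard_pos hS.essFixedPts_finite).1 (lt_of_lt_of_le two_pos hS.two_le)

theorem eq_of_image_Ψ_eq (hS : S.IsSimpleNestedFractal) {i j : Fin S.N}
    (h : S.Ψ i '' S.essFixedPts = S.Ψ j '' S.essFixedPts) : i = j := by
  apply hS.ν_injective
  have hL := S.L_ne_zero
  have : (S.ν i - S.ν j) * S.L = 0 := by
    refine eq_zero_of_image_add_subset hS.essFixedPts_finite hS.essFixedPts_nonempty ?_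
    intro x hx
    have hm : S.Ψ i x ∈ S.Ψ j '' S.essFixedPts := h ▸ ⟨x, hx, rfl⟩
    obtain ⟨y, hy, hxy⟩ := hm
    convert hy using 1
    unfold Ψ at hxy
    field_simp at hxy
    linear_combination -hxy
  rcases mul_eq_zero.1 this with h | h
  · exact sub_eq_zero.1 h
  · exact absurd h hL

/-- Reflections would transport a doubly covered vertex to every other vertex, contradicting
`not_forall_mem_two_cells`. -/
theorem eq_of_mem_two_cells (hS : S.IsSimpleNestedFractal) {x : ℂ} (hx : x ∈ S.essFixedPts)
    {i j : Fin S.N} (hi : x ∈ S.Ψ i '' S.essFixedPts) (hj : x ∈ S.Ψ j '' S.essFixedPts) :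
    i = j := by
  by_contra hij
  refine hS.not_forall_mem_two_cells fun y hy => ?_
  by_cases hxy : x = y
  · subst hxy; exact ⟨i, j, hij, hi, hj⟩
  obtain ⟨i', hi'⟩ := hS.symmetry i x hx y hy hxy
  obtain ⟨j', hj'⟩ := hS.symmetry j x hx y hy hxy
  refine ⟨i', j', ?_, ?_, ?_⟩
  · rintro rfl
    exact hij (hS.eq_of_image_Ψ_eq
      ((bisectorReflection_involutive x y).injective.image_injective (hi'.trans hj'.symm)))
  · rw [← hi']; exact ⟨x, hi, bisectorReflection_left hxy⟩
  · rw [← hj']; exact ⟨x, hj, bisectorReflection_left hxy⟩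

/-- The symmetry axiom only speaks of cells. As `y` lies in no cell but its own, the reflection
takes the cell at `x` to the cell at `y`; these are copies of `V` shrunk by the same factor about
`x` and `y`, so the reflection preserves `V` itself. -/
theorem bisectorReflection_mem_essFixedPts (hS : S.IsSimpleNestedFractal) {x y z : ℂ}
    (hx : x ∈ S.essFixedPts) (hy : y ∈ S.essFixedPts) (hxy : x ≠ y) (hz : z ∈ S.essFixedPts) :
    bisectorReflection x y z ∈ S.essFixedPts := by
  obtain ⟨i, hi⟩ := hx.1
  obtain ⟨j, hj⟩ := hy.1
  obtain ⟨j', hj'⟩ := hS.symmetry i x hx y hy hxy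
  have hmem : y ∈ S.Ψ j' '' S.essFixedPts := by
    rw [← hj']
    exact ⟨x, ⟨x, hx, hi⟩, bisectorReflection_left hxy⟩
  obtain rfl := hS.eq_of_mem_two_cells hy ⟨y, hy, hj⟩ hmem
  obtain ⟨μ, hμ⟩ := S.bisectorReflection_Ψ hxy i
  have hmem2 : bisectorReflection x y (S.Ψ i z) ∈ S.Ψ j '' S.essFixedPts := by
    rw [← hj']
    exact ⟨_, ⟨z, hz, rfl⟩, rfl⟩
  obtain ⟨v, hv, hvz⟩ := hmem2
  have h1 := hμ x
  rw [hi, bisectorReflection_left hxy] at h1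
  have h2 : S.ν j = μ := by
    have h3 := hj
    unfold Ψ at h3
    linear_combination h3 + h1
  rw [hμ z] at hvz
  unfold Ψ at hvz
  rw [h2] at hvz
  have hL := S.L_ne_zero
  have h4 : v = bisectorReflection x y z := by
    field_simp at hvz
    linear_combination hvz
  rwa [← h4]

theorem exists_bisectorReflection_Ψ_eq (hS : S.IsSimpleNestedFractal) {x y : ℂ}
    (hx : x ∈ S.essFixedPts) (hy : y ∈ S.essFixedPts) (hxy : x ≠ y) (i : Fin S.N) :
    ∃ j, ∀ z, bisectorReflection x y (S.Ψ i z) = S.Ψ j (bisectorReflection x y z) := by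
  obtain ⟨j, hj⟩ := hS.symmetry i x hx y hy hxy
  obtain ⟨μ, hμ⟩ := S.bisectorReflection_Ψ hxy i
  have hL := S.L_ne_zero
  have h0 : (μ - S.ν j) * S.L = 0 := by
    refine eq_zero_of_image_add_subset hS.essFixedPts_finite hS.essFixedPts_nonempty ?_
    intro v hv
    have hm : bisectorReflection x y (S.Ψ i (bisectorReflection x y v))
        ∈ S.Ψ j '' S.essFixedPts := by
      rw [← hj]
      exact ⟨_, ⟨_, hS.bisectorReflection_mem_essFixedPts hx hy hxy hv, rfl⟩, rfl⟩
    obtain ⟨q, hq, hqv⟩ := hm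
    rw [hμ, bisectorReflection_involutive] at hqv
    convert hq using 1
    unfold Ψ at hqv
    field_simp at hqv
    linear_combination -hqv
  refine ⟨j, fun z => ?_⟩
  rw [hμ]
  unfold Ψ
  rcases mul_eq_zero.1 h0 with h | h
  · rw [sub_eq_zero.1 h]
  · exact absurd h hL

/-- The reflection permutes the maps `Ψ_i` up to conjugation, so the image of the fractal solves the
same fixed-point equation and uniqueness applies. -/
theorem bisectorReflection_mem_fractal (hS : S.IsSimpleNestedFractal) {x y z : ℂ}
    (hx : x ∈ S.essFixedPts) (hy : y ∈ S.essFixedPts) (hxy : x ≠ y) (hz : z ∈ S.fractal) :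
    bisectorReflection x y z ∈ S.fractal := by
  have hK : S.fractal = bisectorReflection x y '' S.fractal := by
    refine S.existsUnique_fractal.unique S.fractal_spec ⟨S.fractal_spec.1.image _,
      S.fractal_spec.2.1.image (continuous_bisectorReflection x y), ?_⟩
    ext p
    simp only [mem_iUnion, mem_image, exists_exists_and_eq_and]
    constructor
    · rintro ⟨q, hq, rfl⟩
      rw [S.fractal_spec.2.2] at hq
      obtain ⟨i, q', hq', rfl⟩ := mem_iUnion.1 hq
      obtain ⟨j, hj⟩ := hS.exists_bisectorReflection_Ψ_eq hx hy hxy i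
      exact ⟨j, q', hq', (hj q').symm⟩
    · rintro ⟨i, q, hq, rfl⟩
      obtain ⟨j, hj⟩ := hS.exists_bisectorReflection_Ψ_eq hx hy hxy i
      refine ⟨S.Ψ j q, S.Ψ_mem_fractal j hq, ?_⟩
      have h := hj (bisectorReflection x y q)
      rw [bisectorReflection_involutive] at h
      rw [← h, bisectorReflection_involutive]
  rw [hK]
  exact ⟨z, hz, rfl⟩

/-- By connectivity of the cell graph, any two points are joined by chains in the fractal with steps
at most `2 C L⁻ᵐ`, for every `m`. In a compact set this excludes a separation into two closed
pieces, which would be a positive distance apart. -/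
theorem isPreconnected_fractal (hS : S.IsSimpleNestedFractal) : IsPreconnected S.fractal := by
  have hcpt := S.fractal_spec.2.1
  have hL := S.one_lt_L
  obtain ⟨C, hC⟩ := hcpt.isBounded.exists_norm_le
  let R : ℝ → ℂ → ℂ → Prop := fun δ p q => p ∈ S.fractal ∧ q ∈ S.fractal ∧ dist p q ≤ δ
  have chain : ∀ m : ℕ, ∀ p ∈ S.fractal, ∀ q ∈ S.fractal,
      Relation.ReflTransGen (R ((C + C) * S.L⁻¹ ^ m)) p q := by
    intro m
    induction m with
    | zero =>
      intro p hp q hq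
      refine Relation.ReflTransGen.single ⟨hp, hq, ?_⟩
      rw [pow_zero, mul_one, dist_eq_norm]
      exact (norm_sub_le _ _).trans (add_le_add (hC p hp) (hC q hq))
    | succ m ih =>
      have cell : ∀ i, ∀ p ∈ S.Ψ i '' S.fractal, ∀ q ∈ S.Ψ i '' S.fractal,
          Relation.ReflTransGen (R ((C + C) * S.L⁻¹ ^ (m + 1))) p q := by
        rintro i _ ⟨p, hp, rfl⟩ _ ⟨q, hq, rfl⟩
        refine (ih p hp q hq).lift (S.Ψ i) ?_
        rintro a b ⟨ha, hb, hab⟩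
        refine ⟨S.Ψ_mem_fractal i ha, S.Ψ_mem_fractal i hb, ?_⟩
        have : S.Ψ i a - S.Ψ i b = (S.L : ℂ)⁻¹ * (a - b) := by unfold Ψ; ring
        rw [dist_eq_norm, this, norm_mul, norm_inv, Complex.norm_real, Real.norm_eq_abs,
          abs_of_pos (by linarith), pow_succ, ← mul_assoc, mul_comm, ← dist_eq_norm]
        exact mul_le_mul_of_nonneg_right hab (by positivity)
      have vert : ∀ a b : (⋃ i, S.Ψ i '' S.essFixedPts : Set ℂ),
          Relation.ReflTransGen (R ((C + C) * S.L⁻¹ ^ (m + 1))) a b := by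
        intro a b
        obtain ⟨walk⟩ := hS.connectivity.preconnected a b
        induction walk with
        | nil => exact .refl
        | cons h _ ih =>
          obtain ⟨-, i, h1, h2⟩ := h
          exact (cell i _ h1 _ h2).trans ih
      intro p hp q hq
      rw [S.fractal_spec.2.2] at hp hq
      obtain ⟨i, hp⟩ := mem_iUnion.1 hp
      obtain ⟨j, hq⟩ := mem_iUnion.1 hq
      obtain ⟨v, hv⟩ := hS.essFixedPts_nonempty
      have hv' := S.essFixedPts_subset_fractal hv
      exact ((cell i p hp _ ⟨v, hv', rfl⟩).trans
        (vert ⟨_, mem_iUnion.2 ⟨i, v, hv, rfl⟩⟩ ⟨_, mem_iUnion.2 ⟨j, v, hv, rfl⟩⟩)).trans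
        (cell j _ ⟨v, hv', rfl⟩ q hq)
  rw [isPreconnected_closed_iff]
  rintro A B hA hB hAB ⟨a, haK, haA⟩ ⟨b, hbK, hbB⟩
  by_contra hne
  have hdisj : Disjoint (S.fractal ∩ A) (S.fractal ∩ B) := by
    rw [disjoint_left]
    exact fun z h1 h2 => hne ⟨z, h1.1, h1.2, h2.2⟩
  obtain ⟨δ, hδ, hth⟩ := hdisj.exists_thickenings (hcpt.inter_right hA)
    (hcpt.isClosed.inter hB)
  have ht : Tendsto (fun m : ℕ => (C + C) * S.L⁻¹ ^ m) atTop (𝓝 0) := by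
    simpa using (tendsto_pow_atTop_nhds_zero_of_lt_one (by positivity)
      (inv_lt_one_of_one_lt₀ hL)).const_mul (C + C)
  obtain ⟨m, hm⟩ := (ht.eventually (gt_mem_nhds hδ)).exists
  have hstay : ∀ p, Relation.ReflTransGen (R ((C + C) * S.L⁻¹ ^ m)) a p → p ∈ A := by
    intro p hp
    induction hp with
    | refl => exact haA
    | tail _ h ih =>
      obtain ⟨h1, h2, h3⟩ := h
      rcases hAB h2 with h | h
      · exact h
      · exfalso
        refine disjoint_left.1 hth (Metric.self_subset_thickening hδ _ ⟨h1, ih⟩) ?_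
        exact Metric.mem_thickening_iff.2 ⟨_, ⟨h2, h⟩, lt_of_le_of_lt h3 hm⟩
  exact hne ⟨b, hbK, hstay b (chain m a haK b hbK), hbB⟩

end IsSimpleNestedFractal
end SimilitudeSystem

/-! ### The vertices form a regular polygon -/

namespace SimilitudeSystem
open scoped ComplexConjugate

/-- A finite set of `k ≥ 3` nonzero complex numbers that contains `1` and the products `p q r⁻¹`
with `p ≠ q` is the group of `k`-th roots of unity. -/
theorem mem_iff_pow_card_eq_one {G : Finset ℂ} (h3 : 3 ≤ G.card) (h1 : (1 : ℂ) ∈ G)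
    (h0 : ∀ z ∈ G, z ≠ 0)
    (hG : ∀ p ∈ G, ∀ q ∈ G, ∀ r ∈ G, p ≠ q → p * q * r⁻¹ ∈ G) (z : ℂ) :
    z ∈ G ↔ z ^ G.card = 1 := by
  classical
  have hdiv : ∀ p ∈ G, p ≠ 1 → ∀ r ∈ G, p * r⁻¹ ∈ G := fun p hp hne r hr => by
    simpa using hG p hp 1 h1 r hr hne
  have hinv : ∀ w ∈ G, w⁻¹ ∈ G := by
    intro w hw
    -- A third element `y` gives `w⁻¹ = (y * w⁻¹) * y⁻¹`; both quotients are allowed because `y ≠ 1`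
    -- and `y ≠ w`.
    obtain ⟨y, hy⟩ : (G \ {1, w}).Nonempty := by
      apply Finset.card_pos.1
      have := Finset.le_card_sdiff {1, w} G
      have := Finset.card_le_two (a := (1 : ℂ)) (b := w)
      omega
    simp only [Finset.mem_sdiff, Finset.mem_insert, Finset.mem_singleton, not_or] at hy
    obtain ⟨hyG, hy1, hyw⟩ := hy
    have hw0 := h0 w hw
    have hy0 := h0 y hyG
    have h := hdiv _ (hdiv y hyG hy1 w hw) (fun h => hyw (by
      field_simp at h; exact h)) y hyG
    convert h using 1
    field_simp
  have hmul : ∀ p ∈ G, ∀ q ∈ G, p * q ∈ G := by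
    intro p hp q hq
    by_cases hp1 : p = 1
    · simpa [hp1] using hq
    · simpa using hdiv p hp hp1 _ (hinv q hq)
  have hpow : ∀ g ∈ G, g ^ G.card = 1 := by
    intro g hg
    have hinj : Set.InjOn (fun x => g * x) (G : Set ℂ) := fun a _ b _ h =>
      mul_left_cancel₀ (h0 g hg) h
    have him : G.image (fun x => g * x) = G := by
      refine Finset.eq_of_subset_of_card_le ?_ (Finset.card_image_of_injOn hinj).ge
      intro x hx
      obtain ⟨y, hy, rfl⟩ := Finset.mem_image.1 hx
      exact hmul g hg y hy
    -- Multiplication by `g` permutes `G`, so it does not change the product of all elements.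
    have hprod : ∏ x ∈ G, x = g ^ G.card * ∏ x ∈ G, x := by
      conv_lhs => rw [← him, Finset.prod_image hinj]
      rw [Finset.prod_mul_distrib, Finset.prod_const]
    have hne : ∏ x ∈ G, x ≠ 0 := Finset.prod_ne_zero_iff.2 h0
    exact (mul_right_cancel₀ hne (by rw [one_mul]; exact hprod)).symm
  have hpos : 0 < G.card := by omega
  have heq : G = Polynomial.nthRootsFinset G.card (1 : ℂ) := by
    refine Finset.eq_of_subset_of_card_le
      (fun g hg => (Polynomial.mem_nthRootsFinset hpos 1).2 (hpow g hg)) ?_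
    rw [(Complex.isPrimitiveRoot_exp G.card hpos.ne').card_nthRootsFinset]
  conv_lhs => rw [heq]
  exact Polynomial.mem_nthRootsFinset hpos 1

variable {S : SimilitudeSystem}

theorem inv_eq_conj_of_norm {z : ℂ} (h : ‖z‖ = 1) : z⁻¹ = conj z := by
  rw [Complex.inv_def, Complex.normSq_eq_norm_sq, h]; simp

namespace IsSimpleNestedFractal

theorem barycenter_eq (hS : S.IsSimpleNestedFractal) (M : ℤ) :
    S.barycenter M
      = (S.L : ℂ) ^ M * ((∑ v ∈ hS.essFixedPts_finite.toFinset, v) / (S.k : ℂ)) := by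
  have hL : (S.L : ℂ) ^ M ≠ 0 := zpow_ne_zero _ S.L_ne_zero
  unfold barycenter vertices
  rw [finsum_mem_image (fun a _ b _ h => mul_left_cancel₀ hL h),
    finsum_mem_eq_finite_toFinset_sum _ hS.essFixedPts_finite, ← Finset.mul_sum, mul_div_assoc]

theorem bisectorReflection_barycenter (hS : S.IsSimpleNestedFractal) {x y : ℂ}
    (hx : x ∈ S.essFixedPts) (hy : y ∈ S.essFixedPts) (hxy : x ≠ y) :
    bisectorReflection x y (S.barycenter 0) = S.barycenter 0 := by
  set T := hS.essFixedPts_finite.toFinset with hT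
  have hmem : ∀ v, v ∈ T ↔ v ∈ S.essFixedPts := fun v => by simp [hT]
  have hcard : T.card = S.k := (Set.ncard_eq_toFinset_card _ hS.essFixedPts_finite).symm
  have hk : (S.k : ℂ) ≠ 0 := by
    have := hS.two_le
    exact_mod_cast (by omega : S.k ≠ 0)
  have hsum : ∑ v ∈ T, bisectorReflection x y v = ∑ v ∈ T, v := by
    refine Finset.sum_nbij' (bisectorReflection x y) (bisectorReflection x y) ?_ ?_ ?_ ?_ ?_
    · exact fun v hv => (hmem _).2
        (hS.bisectorReflection_mem_essFixedPts hx hy hxy ((hmem v).1 hv))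
    · exact fun v hv => (hmem _).2
        (hS.bisectorReflection_mem_essFixedPts hx hy hxy ((hmem v).1 hv))
    · exact fun v _ => bisectorReflection_involutive x y v
    · exact fun v _ => bisectorReflection_involutive x y v
    · exact fun v _ => rfl
  simp only [bisectorReflection_apply hxy, Finset.sum_add_distrib, ← Finset.mul_sum,
    Finset.sum_const, nsmul_eq_mul, hcard] at hsum
  rw [← map_sum] at hsum
  rw [barycenter_eq hS, bisectorReflection_apply hxy, ← hT]
  simp only [zpow_zero, one_mul, map_div₀, Complex.conj_natCast]
  rw [eq_div_iff hk, add_mul, mul_assoc, div_mul_cancel₀ _ hk]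
  linear_combination hsum

/-- The essential fixed points are the vertices of a regular polygon, whose symmetries are the
reflections of the fractal. -/
theorem exists_regular_polygon (hS : S.IsSimpleNestedFractal) (h3 : 3 ≤ S.k) :
    ∃ c : ℂ, c ≠ 0 ∧ (∀ z, S.barycenter 0 + c * z ∈ S.essFixedPts ↔ z ^ S.k = 1) ∧
      ∀ p q : ℂ, p ^ S.k = 1 → q ^ S.k = 1 → p ≠ q → ∀ z,
        bisectorReflection (S.barycenter 0 + c * p) (S.barycenter 0 + c * q)
          (S.barycenter 0 + c * z) = S.barycenter 0 + c * (p * q * conj z) := by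
  classical
  set b := S.barycenter 0 with hb
  obtain ⟨x₀, hx₀⟩ := hS.essFixedPts_nonempty
  -- The reflections fix the barycenter, so all vertices have the same distance from it.
  have hrad : ∀ x ∈ S.essFixedPts, ∀ y ∈ S.essFixedPts, ‖x - b‖ = ‖y - b‖ := by
    intro x hx y hy
    by_cases hxy : x = y
    · rw [hxy]
    · rw [← dist_eq_norm, ← dist_eq_norm, ← dist_bisectorReflection x y x b,
        bisectorReflection_left hxy, hS.bisectorReflection_barycenter hx hy hxy]
  have hc : x₀ - b ≠ 0 := by
    intro h
    have hsub : S.essFixedPts ⊆ {b} := by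
      intro x hx
      have := hrad x hx x₀ hx₀
      rw [h, norm_zero, norm_eq_zero, sub_eq_zero] at this
      exact this
    have := Set.ncard_le_ncard hsub
    rw [Set.ncard_singleton] at this
    unfold k at h3
    omega
  set c := x₀ - b with hcdef
  have hnorm : ∀ z, b + c * z ∈ S.essFixedPts → ‖z‖ = 1 := by
    intro z hz
    have := hrad _ hz x₀ hx₀
    rw [add_sub_cancel_left, norm_mul, ← hcdef] at this
    exact mul_left_cancel₀ (norm_ne_zero_iff.2 hc) (by rw [this, mul_one])
  have hrefl : ∀ p q : ℂ, b + c * p ∈ S.essFixedPts → b + c * q ∈ S.essFixedPts → p ≠ q →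
      ∀ z, bisectorReflection (b + c * p) (b + c * q) (b + c * z)
        = b + c * (p * q * conj z) := by
    intro p q hp hq hpq z
    have hne : b + c * p ≠ b + c * q := fun h => hpq (mul_left_cancel₀ hc (add_left_cancel h))
    have h1 := hS.bisectorReflection_barycenter hp hq hne
    rw [← hb] at h1
    rw [bisectorReflection_apply hne] at h1 ⊢
    have hp0 : p ≠ 0 := norm_ne_zero_iff.1 (by rw [hnorm p hp]; exact one_ne_zero)
    have hq0 : q ≠ 0 := norm_ne_zero_iff.1 (by rw [hnorm q hq]; exact one_ne_zero)
    have hc' : conj c ≠ 0 := (map_ne_zero _).2 hc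
    have hqp : q - p ≠ 0 := sub_ne_zero.2 hpq.symm
    have hquot : (b + c * q - (b + c * p)) / conj (b + c * q - (b + c * p)) * conj c
        = -(c * (p * q)) := by
      have h2 : b + c * q - (b + c * p) = c * (q - p) := by ring
      rw [h2, map_mul, map_sub (starRingEnd ℂ) q p, ← inv_eq_conj_of_norm (hnorm p hp),
        ← inv_eq_conj_of_norm (hnorm q hq)]
      have h4 : q⁻¹ - p⁻¹ = (q - p) * (-(p * q)⁻¹) := by field_simp; ring
      rw [h4]
      field_simp
    rw [map_add, map_mul, mul_add, add_right_comm, add_comm _ (-_ * (conj c * conj z)),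
      h1]
    linear_combination (-conj z) * hquot
  -- The vertices are normalized so that `x₀` becomes `1`. On the unit circle `conj r = r⁻¹`, so
  -- reflecting `r` gives `p * q * r⁻¹`, as `mem_iff_pow_card_eq_one` requires.
  set G : Finset ℂ := hS.essFixedPts_finite.toFinset.image fun v => (v - b) / c with hG
  have hGmem : ∀ z, z ∈ G ↔ b + c * z ∈ S.essFixedPts := by
    intro z
    simp only [hG, Finset.mem_image, Set.Finite.mem_toFinset]
    constructor
    · rintro ⟨v, hv, rfl⟩
      convert hv using 1
      field_simp
      ring
    · intro h
      exact ⟨_, h, by field_simp; ring⟩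
  have hGcard : G.card = S.k := by
    rw [hG, Finset.card_image_of_injective, ← Set.ncard_eq_toFinset_card _ hS.essFixedPts_finite]
    · rfl
    · intro u v huv
      simp only at huv
      field_simp at huv
      exact sub_left_injective huv
  have hpow : ∀ z, b + c * z ∈ S.essFixedPts ↔ z ^ S.k = 1 := by
    intro z
    rw [← hGmem, ← hGcard]
    refine mem_iff_pow_card_eq_one (hGcard ▸ h3) ?_ ?_ ?_ z
    · rw [hGmem, hcdef]; convert hx₀ using 1; ring
    · intro w hw h
      have := hnorm w ((hGmem w).1 hw)
      rw [h, norm_zero] at this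
      exact zero_ne_one this
    · intro p hp q hq r hr hpq
      rw [hGmem] at hp hq hr ⊢
      rw [inv_eq_conj_of_norm (hnorm r hr), ← hrefl p q hp hq hpq]
      refine hS.bisectorReflection_mem_essFixedPts hp hq ?_ hr
      exact fun h => hpq (mul_left_cancel₀ hc (add_left_cancel h))
  exact ⟨c, hc, hpow, fun p q hp hq => hrefl p q ((hpow p).2 hp) ((hpow q).2 hq)⟩

end IsSimpleNestedFractal
end SimilitudeSystem

/-! ### Cutting at a vertex, the angle condition, and products around a cycle -/

namespace SimilitudeSystem
open scoped ComplexConjugate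

/-- Let a connected set be cut at a point `v` of a finite set `V` by a function which vanishes only
at `v`. If `v` can be exchanged with any other point of `V` by a symmetry, then the smaller part
of `V` is empty. -/
theorem forall_le_of_isPreconnected {X : Type*} [TopologicalSpace X] {K : Set X}
    (hK : IsPreconnected K) {V : Finset X} (hVK : ∀ x ∈ V, x ∈ K) {v : X} (hv : v ∈ V)
    (hsymm : ∀ w ∈ V, w ≠ v → ∃ g : X → X, Continuous g ∧ Function.Involutive g ∧
      (∀ x ∈ K, g x ∈ K) ∧ (∀ x ∈ V, g x ∈ V) ∧ g v = w)
    {f : X → ℝ} (hf : Continuous f) (hfv : f v = 0) (hzero : ∀ x ∈ K, f x = 0 → x = v)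
    (hcard : (V.filter fun x => 0 < f x).card < (V.filter fun x => f x ≤ 0).card) :
    ∀ w ∈ V, f w ≤ 0 := by
  intro w hw
  by_contra! hpos
  obtain ⟨g, hg, hgg, hgK, hgV, hgv⟩ :=
    hsymm w hw (by rintro rfl; exact absurd hfv hpos.ne')
  have hT : IsPreconnected (K ∩ {x | f x ≤ 0}) := by
    -- Collapsing the positive side to `v` is continuous because `f` vanishes on `K` only at `v`;
    -- thus the other side is a retract of `K`.
    have hr : Continuous fun x : K => if f x ≤ 0 then (x : X) else v := by
      refine Continuous.if_le continuous_subtype_val continuous_const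
        (hf.comp continuous_subtype_val) continuous_const ?_
      exact fun x hx => hzero x x.2 hx
    have himage : K ∩ {x | f x ≤ 0} = (fun x : K => if f x ≤ 0 then (x : X) else v) '' univ := by
      ext y
      constructor
      · rintro ⟨hy, hfy⟩
        exact ⟨⟨y, hy⟩, mem_univ _, if_pos hfy⟩
      · rintro ⟨x, -, rfl⟩
        by_cases h : f x ≤ 0
        · simp only [h, if_true]; exact ⟨x.2, h⟩
        · simp only [h, if_false]; exact ⟨hVK v hv, hfv.le⟩
    rw [himage]
    exact (isPreconnected_iff_preconnectedSpace.1 hK).isPreconnected_univ.image _ hr.continuousOn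
  -- A sign change of `f ∘ g` on this connected side would give a zero `y` there, so `g y = v` and
  -- `y = w`, although `f w > 0`. Hence `g` injects the larger part of `V` into the smaller one.
  have hsign : ∀ x ∈ K ∩ {x | f x ≤ 0}, 0 < f (g x) := by
    intro x hx
    by_contra! hneg
    have hmem := hT.intermediate_value hx ⟨hVK v hv, hfv.le⟩
      (hf.comp hg).continuousOn (f := f ∘ g)
    obtain ⟨y, ⟨hyK, hy⟩, hy0⟩ := hmem ⟨hneg, by simp [hgv, hpos.le]⟩
    have hyv := hzero _ (hgK y hyK) hy0
    have : y = w := by rw [← hgv, ← hyv, hgg]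
    rw [this] at hy
    exact absurd hpos (not_lt.2 hy)
  refine absurd hcard (not_lt.2 ?_)
  refine Finset.card_le_card_of_injOn g ?_ hgg.injective.injOn
  intro x hx
  have hx' := Finset.mem_filter.1 hx
  exact Finset.mem_coe.2
    (Finset.mem_filter.2 ⟨hgV x hx'.1, hsign x ⟨hVK x hx'.1, hx'.2⟩⟩)

theorem re_exp_sub_one_mul (α β : ℝ) :
    ((Complex.exp (2 * α * Complex.I) - 1) * (1 - Complex.exp (2 * β * Complex.I))).re
      = 4 * Real.sin α * Real.sin β * Real.cos (α + β) := by
  have h : ∀ t : ℝ, Complex.exp (2 * t * Complex.I)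
      = (1 - 2 * Real.sin t ^ 2 : ℝ) + (2 * Real.sin t * Real.cos t : ℝ) * Complex.I := by
    intro t
    have h1 : (2 * t : ℂ) = ((2 * t : ℝ) : ℂ) := by push_cast; ring
    rw [h1, Complex.exp_mul_I, ← Complex.ofReal_cos, ← Complex.ofReal_sin, Real.sin_two_mul,
      Real.cos_two_mul, Real.cos_sq']
    congr 2
    ring
  rw [h, h, Real.cos_add]
  simp only [Complex.mul_re, Complex.mul_im, Complex.add_re, Complex.add_im, Complex.sub_re,
    Complex.sub_im, Complex.one_re, Complex.one_im, Complex.I_re, Complex.I_im,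
    Complex.ofReal_re, Complex.ofReal_im]
  ring

/-- With `ω = ζ ^ D`, the choices `e = ζ` and `e = ζ⁻¹` give `cos (π(D+1)/k) ≤ 0` and `cos
(π(D-1)/k) ≥ 0`, that is `k - 2 ≤ 2D ≤ k + 2`. Parity leaves `2D = k ± 1`. -/
theorem sq_eq_of_forall_re_nonpos {k : ℕ} (hk : Odd k) (h3 : 3 ≤ k) {ω : ℂ} (hω : ω ^ k = 1)
    (hω1 : ω ≠ 1) (h : ∀ e : ℂ, e ^ k = 1 → ((e - 1) * (1 - ω)).re ≤ 0) :
    ω ^ 2 = Complex.exp (2 * Real.pi * Complex.I / k) ∨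
      ω ^ 2 = (Complex.exp (2 * Real.pi * Complex.I / k))⁻¹ := by
  have hζ := Complex.isPrimitiveRoot_exp k (by omega)
  set ζ := Complex.exp (2 * Real.pi * Complex.I / k) with hζdef
  obtain ⟨D, hDk, rfl⟩ :=
    have : NeZero k := ⟨by omega⟩
    hζ.eq_pow_of_pow_eq_one hω
  have hD0 : 0 < D := by
    rcases Nat.eq_zero_or_pos D with rfl | h
    · simp at hω1
    · exact h
  have hkpos : (0 : ℝ) < k := by exact_mod_cast (by omega : 0 < k)
  have hkC : (k : ℂ) ≠ 0 := by exact_mod_cast hkpos.ne'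
  have hDr : (0 : ℝ) < D := by exact_mod_cast hD0
  have hDkr : (D : ℝ) < k := by exact_mod_cast hDk
  have hπ := Real.pi_pos
  have hexpD : ζ ^ D = Complex.exp (2 * (Real.pi * D / k : ℝ) * Complex.I) := by
    rw [hζdef, ← Complex.exp_nat_mul]
    congr 1
    push_cast
    field_simp
  have hexp1 : ζ = Complex.exp (2 * (Real.pi / k : ℝ) * Complex.I) := by
    rw [hζdef]
    congr 1
    push_cast
    field_simp
  have hexpm : ζ⁻¹ = Complex.exp (2 * (-(Real.pi / k) : ℝ) * Complex.I) := by
    rw [hζdef, ← Complex.exp_neg]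
    congr 1
    push_cast
    field_simp
  have hs1 : 0 < Real.sin (Real.pi / k) := by
    apply Real.sin_pos_of_pos_of_lt_pi (by positivity)
    rw [div_lt_iff₀ hkpos]
    have : (1 : ℝ) < k := by exact_mod_cast (by omega : 1 < k)
    nlinarith
  have hsD : 0 < Real.sin (Real.pi * D / k) := by
    apply Real.sin_pos_of_pos_of_lt_pi (by positivity)
    rw [div_lt_iff₀ hkpos]
    nlinarith
  have hup := h ζ hζ.pow_eq_one
  have hdown := h ζ⁻¹ (by rw [inv_pow, hζ.pow_eq_one, inv_one])
  rw [hexpD, hexp1, re_exp_sub_one_mul] at hup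
  rw [hexpD, hexpm, re_exp_sub_one_mul, Real.sin_neg] at hdown
  have hlow : k ≤ 2 * D + 2 := by
    by_contra! hlt
    have hltr : (2 * D + 2 : ℝ) < k := by exact_mod_cast hlt
    have : 0 < Real.cos (Real.pi / k + Real.pi * D / k) := by
      have hpos : 0 < Real.pi / k + Real.pi * D / k := by positivity
      apply Real.cos_pos_of_mem_Ioo
      refine ⟨by linarith, ?_⟩
      rw [← add_div, div_lt_iff₀ hkpos]
      nlinarith
    have : 0 < 4 * Real.sin (Real.pi / k) * Real.sin (Real.pi * D / k)
      * Real.cos (Real.pi / k + Real.pi * D / k) := by positivity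
    linarith
  have hhigh : 2 * D ≤ k + 2 := by
    by_contra! hlt
    have hltr : (k + 2 : ℝ) < 2 * D := by exact_mod_cast hlt
    have hneg : Real.cos (-(Real.pi / k) + Real.pi * D / k) < 0 := by
      have heq : -(Real.pi / k) + Real.pi * D / k = Real.pi * (D - 1) / k := by ring
      rw [heq]
      apply Real.cos_neg_of_pi_div_two_lt_of_lt
      · rw [lt_div_iff₀ hkpos]; nlinarith
      · rw [div_lt_iff₀ hkpos]; nlinarith
    have := mul_pos (mul_pos hs1 hsD) (neg_pos.2 hneg)
    nlinarith
  obtain ⟨t, ht⟩ := hk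
  have h2 : (ζ ^ D) ^ 2 = ζ ^ (2 * D) := by rw [← pow_mul, mul_comm]
  rw [h2]
  rcases (by omega : 2 * D = k + 1 ∨ 2 * D + 1 = k) with h | h
  · left
    rw [h, pow_succ, hζ.pow_eq_one, one_mul]
  · right
    refine eq_inv_of_mul_eq_one_left ?_
    rw [← pow_succ, h, hζ.pow_eq_one]

theorem no_short_odd_product {k j : ℕ} (hj : Odd j) (hjk : j < k) {η ω : Fin j → ℂ}
    (hη : ∀ i, η i ≠ 0) (hstep : ∀ i, η (finRotate j i) = η i * ω i)
    (hω : ∀ i, ω i ^ 2 = Complex.exp (2 * Real.pi * Complex.I / k) ∨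
      ω i ^ 2 = (Complex.exp (2 * Real.pi * Complex.I / k))⁻¹) : False := by
  have hζ := Complex.isPrimitiveRoot_exp k (by omega)
  set ζ := Complex.exp (2 * Real.pi * Complex.I / k) with hζdef
  have hprod : ∏ i, ω i = 1 := by
    have h1 : ∏ i, η (finRotate j i) = ∏ i, η i := Equiv.prod_comp (finRotate j) η
    simp only [hstep, Finset.prod_mul_distrib] at h1
    exact mul_left_cancel₀ (Finset.prod_ne_zero_iff.2 fun i _ => hη i) (by rw [h1, mul_one])
  have hε : ∀ i, ∃ ε : ℤ, (ε = 1 ∨ ε = -1) ∧ ω i ^ 2 = ζ ^ ε := by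
    intro i
    rcases hω i with h | h
    · exact ⟨1, Or.inl rfl, by rw [h, zpow_one]⟩
    · exact ⟨-1, Or.inr rfl, by rw [h, zpow_neg_one]⟩
  choose ε hε1 hε2 using hε
  have hzpow : ζ ^ (∑ i, ε i) = 1 := by
    have h0 : ζ ≠ 0 := Complex.exp_ne_zero _
    have : ∀ s : Finset (Fin j), ζ ^ (∑ i ∈ s, ε i) = ∏ i ∈ s, ζ ^ ε i := by
      classical
      intro s
      induction s using Finset.induction_on with
      | empty => simp
      | insert a s ha ih => rw [Finset.sum_insert ha, Finset.prod_insert ha, zpow_add₀ h0, ih]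
    rw [this]
    simp only [← hε2]
    rw [Finset.prod_pow, hprod, one_pow]
  have hdvd : (k : ℤ) ∣ ∑ i, ε i := (hζ.zpow_eq_one_iff_dvd _).1 hzpow
  have habs : |∑ i, ε i| < k := by
    calc |∑ i, ε i| ≤ ∑ i, |ε i| := Finset.abs_sum_le_sum_abs _ _
      _ = j := by
        have : ∀ i, |ε i| = 1 := fun i => by rcases hε1 i with h | h <;> simp [h]
        simp [this]
      _ < k := by exact_mod_cast hjk
  have hzero := Int.eq_zero_of_abs_lt_dvd hdvd habs
  have hparity : ∀ i, ∃ d : ℤ, ε i = 1 + 2 * d := fun i => by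
    rcases hε1 i with h | h
    · exact ⟨0, by rw [h]; rfl⟩
    · exact ⟨-1, by rw [h]; rfl⟩
  choose d hd using hparity
  have hsum : ∑ i, ε i = j + 2 * ∑ i, d i := by
    simp [hd, Finset.sum_add_distrib, ← Finset.mul_sum]
  obtain ⟨t, ht⟩ := hj
  omega

end SimilitudeSystem

/-! ### Adjacent complexes, labellings and cycles -/

namespace SimilitudeSystem
open scoped ComplexConjugate

variable {S : SimilitudeSystem}

namespace IsSimpleNestedFractal

/-- Two translates of the fractal that share a vertex, which has the positions `p` and `q` in
them, meet in nearly opposite vertices. -/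
theorem sq_div_eq (hS : S.IsSimpleNestedFractal) (hk : Odd S.k) (h3 : 3 ≤ S.k) {b c : ℂ}
    (hc : c ≠ 0) (hpoly : ∀ z, b + c * z ∈ S.essFixedPts ↔ z ^ S.k = 1)
    (hrefl : ∀ p q : ℂ, p ^ S.k = 1 → q ^ S.k = 1 → p ≠ q → ∀ z,
      bisectorReflection (b + c * p) (b + c * q) (b + c * z) = b + c * (p * q * conj z))
    {m : ℕ} {w w' : Fin m → Fin S.N} (hw : w ≠ w') {p q : ℂ} (hp : p ^ S.k = 1)
    (hq : q ^ S.k = 1) (hpq : c * p + S.shift 0 w = c * q + S.shift 0 w') :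
    (p / q) ^ 2 = Complex.exp (2 * Real.pi * Complex.I / S.k) ∨
      (p / q) ^ 2 = (Complex.exp (2 * Real.pi * Complex.I / S.k))⁻¹ := by
  classical
  have hk0 : S.k ≠ 0 := by omega
  have hne : p ≠ q := by
    rintro rfl
    exact hw (hS.shift_injective m (add_left_cancel hpq))
  have hnorm : ∀ z : ℂ, z ^ S.k = 1 → ‖z‖ = 1 := fun z hz =>
    Complex.norm_eq_one_of_pow_eq_one hz hk0
  have hp0 : p ≠ 0 := norm_ne_zero_iff.1 (by rw [hnorm p hp]; exact one_ne_zero)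
  have hq0 : q ≠ 0 := norm_ne_zero_iff.1 (by rw [hnorm q hq]; exact one_ne_zero)
  have hcp : conj p = p⁻¹ := (inv_eq_conj_of_norm (hnorm p hp)).symm
  have hcq : conj q = q⁻¹ := (inv_eq_conj_of_norm (hnorm q hq)).symm
  have hV : ∀ x, ∃ z, x = b + c * z := fun x => ⟨(x - b) / c, by field_simp; ring⟩
  have hpV := (hpoly p).2 hp
  have hqV := (hpoly q).2 hq
  have hneV : b + c * p ≠ b + c * q := fun h => hne (mul_left_cancel₀ hc (add_left_cancel h))
  -- Up to scale, the signed distance from the line through the shared vertex orthogonal to `c * (p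
  -- - q)`.
  let f : ℂ → ℝ := fun x => (((x - b) / c - p) * conj (p - q)).re
  have hf : ∀ z, f (b + c * z) = ((z - p) * conj (p - q)).re := by
    intro z
    simp only [f]
    rw [add_sub_cancel_left, mul_div_cancel_left₀ _ hc]
  have hfc : Continuous f := by fun_prop
  have hfp : f (b + c * p) = 0 := by rw [hf]; simp
  have hzero : ∀ x ∈ S.fractal, f x = 0 → x = b + c * p := by
    intro x hx hfx
    obtain ⟨z, rfl⟩ := hV x
    rw [hf] at hfx
    have hfx2 : (z - p) * conj (p - q) + conj (z - p) * (p - q) = 0 := by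
      have h := Complex.add_conj ((z - p) * conj (p - q))
      rw [hfx, map_mul, Complex.conj_conj] at h
      simpa using h
    -- On the line, the position in the second complex is `p * q * conj z`, the reflection of `z`.
    -- Hence the point belongs to both complexes and is a vertex; then `z = p` or `z = -q`, and the
    -- latter is not a root of unity as `k` is odd.
    have hmirror : z = p * q * conj z + (p - q) := by
      simp only [map_sub, hcp, hcq] at hfx2
      have hqp : p - q ≠ 0 := sub_ne_zero.2 hne
      field_simp at hfx2
      refine mul_left_cancel₀ hqp ?_
      linear_combination -hfx2
    have hx' : b + c * z + S.shift 0 w - S.shift 0 w' ∈ S.fractal := by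
      have h := hS.bisectorReflection_mem_fractal hpV hqV hneV hx
      rw [hrefl p q hp hq hne] at h
      convert h using 1
      linear_combination c * hmirror + hpq
    have hzV := (hS.mem_essFixedPts_of_mem_inter w w' hw
      (z := b + c * z + S.shift 0 w) (by simpa using hx) hx').1
    rw [add_sub_cancel_right, hpoly] at hzV
    have hz0 : z ≠ 0 := norm_ne_zero_iff.1 (by rw [hnorm z hzV]; exact one_ne_zero)
    rw [← inv_eq_conj_of_norm (hnorm z hzV)] at hmirror
    field_simp at hmirror
    have hfac : (z - p) * (z + q) = 0 := by linear_combination hmirror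
    rcases mul_eq_zero.1 hfac with h | h
    · rw [sub_eq_zero.1 h]
    · rw [eq_neg_of_add_eq_zero_left h, hk.neg_pow, hq] at hzV
      norm_num at hzV
  set V := hS.essFixedPts_finite.toFinset with hVdef
  have hmem : ∀ v, v ∈ V ↔ v ∈ S.essFixedPts := fun v => by simp [hVdef]
  have hre : 0 ≤ (1 - p / q).re := by
    have : (p / q).re ≤ 1 := by
      refine (Complex.re_le_norm _).trans ?_
      rw [norm_div, hnorm p hp, hnorm q hq, div_one]
    simpa using this
  have hflip : ∀ z, f (b + c * (p * q * conj z)) = - f (b + c * z) - 2 * (1 - p / q).re := by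
    intro z
    rw [hf, hf]
    have h1 : (p * q * conj z - p) * conj (p - q) =
        - conj ((z - p) * conj (p - q)) - (1 - p / q) - conj (1 - p / q) := by
      simp only [map_mul, map_sub, map_div₀, map_inv₀, inv_inv, map_one, hcp, hcq]
      field_simp
      ring
    rw [h1]
    simp only [Complex.sub_re, Complex.neg_re, Complex.conj_re]
    ring
  -- The reflection exchanging the positions `p` and `q` sends vertices with `f > 0` to vertices
  -- with `f < 0`, and the shared vertex, where `f = 0`, makes the inequality strict.
  have hcard : (V.filter fun x => 0 < f x).card < (V.filter fun x => f x ≤ 0).card := by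
    have hinj := (bisectorReflection_involutive (b + c * p) (b + c * q)).injective
    rw [← Finset.card_image_of_injective _ hinj]
    have hlt : ∀ x ∈ (V.filter fun x => 0 < f x).image
        (bisectorReflection (b + c * p) (b + c * q)), x ∈ V ∧ f x < 0 := by
      intro x hx
      obtain ⟨y, hy, rfl⟩ := Finset.mem_image.1 hx
      obtain ⟨hyV, hfy⟩ := Finset.mem_filter.1 hy
      refine ⟨(hmem _).2 (hS.bisectorReflection_mem_essFixedPts hpV hqV hneV
        ((hmem _).1 hyV)), ?_⟩
      obtain ⟨z, rfl⟩ := hV y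
      rw [hrefl p q hp hq hne, hflip]
      linarith
    refine Finset.card_lt_card (Finset.ssubset_iff_subset_ne.2 ⟨fun x hx => ?_, fun heq => ?_⟩)
    · exact Finset.mem_filter.2 ⟨(hlt x hx).1, (hlt x hx).2.le⟩
    · have : b + c * p ∈ V.filter fun x => f x ≤ 0 :=
        Finset.mem_filter.2 ⟨(hmem _).2 hpV, hfp.le⟩
      rw [← heq] at this
      exact absurd hfp (hlt _ this).2.ne
  have hside := forall_le_of_isPreconnected hS.isPreconnected_fractal
    (fun x hx => S.essFixedPts_subset_fractal ((hmem x).1 hx)) ((hmem _).2 hpV)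
    (fun x hx hxp => ⟨bisectorReflection (b + c * p) x, continuous_bisectorReflection _ _,
      bisectorReflection_involutive _ _,
      fun y hy => hS.bisectorReflection_mem_fractal hpV ((hmem x).1 hx) hxp.symm hy,
      fun y hy => (hmem _).2
        (hS.bisectorReflection_mem_essFixedPts hpV ((hmem x).1 hx) hxp.symm ((hmem y).1 hy)),
      bisectorReflection_left hxp.symm⟩)
    hfc hfp hzero hcard
  refine sq_eq_of_forall_re_nonpos hk h3 (by rw [div_pow, hp, hq, div_one])
    (fun h => hne (by field_simp at h; exact h)) fun e he => ?_
  have h := hside (b + c * (p * e)) ((hmem _).2 ((hpoly _).2 (by rw [mul_pow, hp, he, one_mul])))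
  rw [hf] at h
  convert h using 2
  simp only [map_sub, hcp, hcq]
  field_simp

end IsSimpleNestedFractal

/-- Padding all words by the same letter `i` translates all complexes by a common vector, so their
relative positions are kept. -/
theorem exists_extension {i : Fin S.N} (m n : ℕ) :
    ∃ τ : ℂ, (S.ν i = 0 → τ = 0) ∧ ∀ w : Fin m → Fin S.N, ∃ w' : Fin (m + n) → Fin S.N,
      S.shift 0 w' = S.shift 0 w + τ := by
  induction n with
  | zero => exact ⟨0, fun _ => rfl, fun w => ⟨w, by simp⟩⟩
  | succ n ih =>
    obtain ⟨τ, hτ, h⟩ := ih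
    refine ⟨τ + (S.L : ℂ) ^ (m + n + 1) * S.ν i, fun h0 => by simp [hτ h0, h0], fun w => ?_⟩
    obtain ⟨w', hw'⟩ := h w
    refine ⟨(Fin.snoc w' i : Fin (m + n + 1) → Fin S.N), ?_⟩
    rw [← add_assoc (S.shift 0 w), ← hw']
    convert S.shift_succ (Fin.snoc w' i : Fin (m + n + 1) → Fin S.N) using 2
    · rw [Fin.init_snoc]
    · rw [Fin.snoc_last]

/-- A good labelling of any order labels the vertices of the `0`-complexes in `K^⟨m⟩` so that each
complex is labelled by a rotation of one fixed injective labelling of the polygon. -/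
theorem HasGLP.exists_labelling (hGLP : S.HasGLP) (hS : S.IsSimpleNestedFractal) {c : ℂ}
    (hc : c ≠ 0)
    (hpoly : ∀ z, S.barycenter 0 + c * z ∈ S.essFixedPts ↔ z ^ S.k = 1) {m : ℕ} (hm : 1 ≤ m) :
    ∃ (ℓ ℓ₀ : ℂ → Fin S.k), Set.InjOn ℓ₀ {z | z ^ S.k = 1} ∧
      ∀ w : Fin m → Fin S.N, ∃ η : ℂ, η ^ S.k = 1 ∧ η ≠ 0 ∧
        ∀ p : ℂ, p ^ S.k = 1 → ℓ (S.barycenter 0 + c * p + S.shift 0 w) = ℓ₀ (η * p) := by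
  obtain ⟨M, ℓ, hℓ⟩ := hGLP
  have hL : (S.L : ℂ) ^ M ≠ 0 := zpow_ne_zero _ S.L_ne_zero
  have hk : (S.k : ℂ) ≠ 0 := by
    have := hS.two_le
    exact_mod_cast (by omega : S.k ≠ 0)
  have hbary : S.barycenter M = (S.L : ℂ) ^ M * S.barycenter 0 := by
    rw [hS.barycenter_eq, hS.barycenter_eq, zpow_zero, one_mul]
  -- For negative `M`, the extra `(-M).toNat` letters bring the top scale `M + m + (-M).toNat` to at
  -- least `0`, so that the complexes lie in the unbounded fractal.
  obtain ⟨τ, -, hτ⟩ := exists_extension (S := S) (i := ⟨0, S.N_pos⟩) m (-M).toNat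
  refine ⟨fun x => ℓ ((S.L : ℂ) ^ M * (x + τ)),
    fun z => ℓ ((S.L : ℂ) ^ M * (S.barycenter 0 + c * z)), ?_, fun w => ?_⟩
  · intro p hp q hq h
    have := hℓ.bijOn.injOn ⟨_, (hpoly p).2 hp, rfl⟩ ⟨_, (hpoly q).2 hq, rfl⟩ h
    exact mul_left_cancel₀ hc (add_left_cancel (mul_left_cancel₀ hL this))
  · obtain ⟨w', hw'⟩ := hτ w
    obtain ⟨r, -, hr⟩ := hℓ.rotate _ w' (by omega)
      (S.complexOf_subset_unboundedFractal (by push_cast; omega) w')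
    refine ⟨Complex.exp (2 * Real.pi * Complex.I * r / S.k), ?_, Complex.exp_ne_zero _, ?_⟩
    · rw [← Complex.exp_nat_mul, Complex.exp_eq_one_iff]
      refine ⟨r, ?_⟩
      push_cast
      field_simp
    · intro p hp
      have h := hr _ ⟨_, ⟨_, (hpoly p).2 hp, rfl⟩, rfl⟩
      simp only [add_sub_cancel_right] at h
      unfold rotation at h
      rw [S.shift_eq_mul, hw', hbary] at h
      convert h using 2 <;> ring

theorem no_short_odd_cycle (hS : S.IsSimpleNestedFractal) (hk : Odd S.k) (hGLP : S.HasGLP)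
    {m : ℕ} (hm : 1 ≤ m) {j : ℕ} (hj : Odd j) (hjk : j < S.k) :
    ¬ ∃ c : Fin j → Set ℂ, (∀ i, S.IsComplexIn 0 m (c i)) ∧ IsComplexCycle c := by
  rintro ⟨Δ, hΔ, -, hadj⟩
  have h3 : 3 ≤ S.k := by
    have := hS.two_le
    obtain ⟨t, ht⟩ := hk
    omega
  obtain ⟨c, hc, hpoly, hrefl⟩ := hS.exists_regular_polygon h3
  obtain ⟨ℓ, ℓ₀, hinj, hℓ⟩ := hGLP.exists_labelling hS hc hpoly hm
  choose w hw using hΔ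
  choose η hη1 hη0 hη using hℓ
  have hstep : ∀ i, ∃ ω : ℂ, η (w (finRotate j i)) = η (w i) * ω ∧
      (ω ^ 2 = Complex.exp (2 * Real.pi * Complex.I / S.k) ∨
        ω ^ 2 = (Complex.exp (2 * Real.pi * Complex.I / S.k))⁻¹) := by
    intro i
    obtain ⟨hne, y, hy, hy'⟩ := hadj i
    rw [hw, S.mem_complexOf_zero] at hy hy'
    have hww : w i ≠ w (finRotate j i) := fun h => hne (by rw [hw, hw (finRotate j i), h])
    obtain ⟨hv, hv'⟩ := hS.mem_essFixedPts_of_mem_inter _ _ hww hy hy'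
    have hV : ∀ x, ∃ z, x = S.barycenter 0 + c * z := fun x =>
      ⟨(x - S.barycenter 0) / c, by field_simp; ring⟩
    obtain ⟨p, hp⟩ := hV (y - S.shift 0 (w i))
    obtain ⟨q, hq⟩ := hV (y - S.shift 0 (w (finRotate j i)))
    rw [hp, hpoly] at hv
    rw [hq, hpoly] at hv'
    have hq0 : q ≠ 0 := by
      rintro rfl
      rw [zero_pow (by omega)] at hv'
      exact zero_ne_one hv'
    refine ⟨p / q, ?_, hS.sq_div_eq hk h3 hc hpoly hrefl hww hv hv' ?_⟩
    · have h1 := hη (w i) p hv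
      have h2 := hη (w (finRotate j i)) q hv'
      rw [← hp, sub_add_cancel] at h1
      rw [← hq, sub_add_cancel] at h2
      -- Both complexes give the shared vertex the same label, so injectivity of `ℓ₀` yields `η * p
      -- = η' * q`.
      have h := hinj (show (η (w i) * p) ^ S.k = 1 by rw [mul_pow, hη1, hv, one_mul])
        (show (η (w (finRotate j i)) * q) ^ S.k = 1 by rw [mul_pow, hη1, hv', one_mul]) (h1.symm.trans h2)
      field_simp
      exact h.symm
    · linear_combination hq - hp
  choose ω hω1 hω2 using hstep
  exact no_short_odd_product hj hjk (fun i => hη0 (w i)) hω1 hω2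

theorem IsComplexIn.of_le {i : Fin S.N} (hi : S.ν i = 0) {m m' : ℕ} (h : m ≤ m') {Δ : Set ℂ}
    (hΔ : S.IsComplexIn 0 m Δ) : S.IsComplexIn 0 m' Δ := by
  obtain ⟨w, rfl⟩ := hΔ
  obtain ⟨n, rfl⟩ := Nat.exists_eq_add_of_le h
  obtain ⟨τ, hτ, hext⟩ := exists_extension (S := S) (i := i) m n
  obtain ⟨w', hw'⟩ := hext w
  refine ⟨w', ?_⟩
  unfold complexOf
  rw [hw', hτ hi, add_zero]

end SimilitudeSystem

theorem mainTheorem8 (S : SimilitudeSystem) (hS : S.IsSimpleNestedFractal)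
    (hk : Odd S.k) (hGLP : S.HasGLP) :
    (∀ m : ℕ, 1 ≤ m → ∀ j : ℕ, Odd j → j < S.k →
      ¬ ∃ c : Fin j → Set ℂ, (∀ i, S.IsComplexIn 0 m (c i)) ∧ IsComplexCycle c) ∧
    ((∃ i, S.ν i = 0) → ∀ j : ℕ, Odd j → j < S.k →
      ¬ ∃ c : Fin j → Set ℂ, (∀ i, S.IsComplex 0 (c i)) ∧ IsComplexCycle c) := by
  refine ⟨fun m hm j hj hjk => SimilitudeSystem.no_short_odd_cycle hS hk hGLP hm hj hjk, ?_⟩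
  rintro ⟨i₀, hi₀⟩ j hj hjk ⟨c, hc, hcyc⟩
  choose hsub m hm hcm using hc
  -- This level dominates every `m i`; padding with the letter whose translation is zero moves no
  -- complex.
  refine SimilitudeSystem.no_short_odd_cycle hS hk hGLP (m := 1 + ∑ i, m i) (by omega) hj hjk
    ⟨c, fun i => (hcm i).of_le hi₀ ?_, hcyc⟩
  have := Finset.single_le_sum (fun i _ => Nat.zero_le (m i)) (Finset.mem_univ i)
  omega
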